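/- Let $\mathcal N$ be a finite set with $n$ elements, let $k\in\{1,\dots,n\}$, and let $f:2^{\mathcal N}\to\mathbb R_+$ be monotone and submodular with $f(\emptyset)=0$. Let $\mathbf r\in[0,1]^{\mathcal N}$ be feasible, i.e. there is a random sequence $(S_1,S_2,\dots)$ of subsets of $\mathcal N$ with $|S_t|\le k$ for all $t$ and $$\liminf_{T\to\infty}\frac1T\sum_{t=1}^T\mathbb P(u\in S_t)\ge r_u\qquad\text{for all }u\in\mathcal N .\tag{1}$$ Let $U_{\mathrm{opt}}$ be the supremum of $\liminf_{T\to\infty}\frac1T\sum_{t=1}^T\mathbb E[f(S_t)]$ over all random sequences of subsets of size at most $k$ that satisfy (1). Let $$F(\mathbf y)=\sum_{S\subseteq\mathcal N}f(S)\prod_{u\in S}y_u\prod_{v\notin S}(1-y_v)$$ be the multilinear extension of $f$, and let $P_f=\{\mathbf y\in[0,1]^{\mathcal N}:\ \mathbf r\le\mathbf y\le\mathbf 1,\ \sum_u y_u\le k\}$. The algorithm FairCG2 (in continuous time) works in two steps. *Step 1.* A path $\mathbf y:[0,1]\to\mathbb R^{\mathcal N}$ starts at $\mathbf y(0)=\mathbf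 r$ and moves at rate $\frac{d\mathbf y(\tau)}{d\tau}=\mathbf x(\tau)-\mathbf r$, i.e. $\mathbf y(\tau)=\mathbf r+\int_0^\tau(\mathbf x(s)-\mathbf r)\,ds$, where for each $\tau\in[0,1)$ the vector $\mathbf x(\tau)$ is a maximizer of $\sum_u x_u w_u(\tau)$ over $\mathbf x\in P_f$ with $w_u(\tau)=F(\mathbf y(\tau)\vee\mathbf 1_u)-F(\mathbf y(\tau))$; here $\mathbf 1_u$ is the standard basis vector of $u$, $\vee$ is the coordinatewise maximum, and ties are broken so that $\sum_u x_u(\tau)=k$ (possible since $w_u(\tau)\ge0$). *Step 2.* In each round $t=1,2,\dots$ the random set $S_t$ is obtained by dependent rounding of $\mathbf y(1)$: starting from $\mathbf y=\mathbf y(1)$, as long as $\mathbf y$ has a coordinate in $(0,1)$, find any $u\ne v$ with $y_u,y_v\in(0,1)$, set $a=\min\{1-y_u,y_v\}$ and $b=\min\{y_u,1-y_v\}$, and replace $(y_u,y_v)$ by $(y_u+a,y_v-a)$ with probability $\frac b{a+b}$ and by $(y_u-b,y_v+b)$ with probability $\frac a{a+b}$; at the end return $S_t=\{u:y_u=1\}$.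 Then for every such run $\mathbf y(\tau)\in P_f$ for all $\tau\in[0,1]$, and $$\liminf_{T\to\infty}\frac1T\sum_{t=1}^T\mathbb E[f(S_t)]\ \ge\ \bigl(1-e^{-c_{\mathbf r}}\bigr)\,U_{\mathrm{opt}}+F(\mathbf r)\,e^{-c_{\mathbf r}},\qquad c_{\mathbf r}=1-\max\Bigl\{\max_u r_u,\ \tfrac1k\sum_u r_u\Bigr\}.$$ -/

import Mathlib

open MeasureTheory Filter

namespace FairCG

noncomputable section

/-- Submodularity of a set function: marginal gains decrease. -/
def IsSubmodular {N : Type*} [DecidableEq N] (f : Finset N → ℝ) : Prop :=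
  ∀ A B : Finset N, A ⊆ B → ∀ u, u ∉ B → f (insert u B) - f B ≤ f (insert u A) - f A

/-- The multilinear extension of a set function. -/
def multilinearExt {N : Type*} [Fintype N] [DecidableEq N] (f : Finset N → ℝ) (y : N → ℝ) : ℝ :=
  ∑ S : Finset N, f S * ((∏ u ∈ S, y u) * ∏ v ∈ Sᶜ, (1 - y v))

/-- The polytope of vectors `y` in the unit cube with `r ≤ y ≤ 1` and coordinate sum at most `k`. -/
def polytope {N : Type*} [Fintype N] (k : ℕ) (r : N → ℝ) : Set (N → ℝ) :=
  {y | (∀ u, 0 ≤ y u) ∧ (∀ u, r u ≤ y u) ∧ (∀ u, y u ≤ 1) ∧ ∑ u, y u ≤ (k : ℝ)}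

/-! ### The multi-round problem. A (randomized, possibly history-dependent) algorithm is represented
by the random sequence of sets that it selects, on some probability space. `S t` is the set selected
in round `t + 1`, so the first `T` rounds are indexed by `Finset.range T`. -/

/-- A random sequence of subsets of the (finite) ground set: each `S t` is a random variable. -/
def IsRandomSeq {N Ω : Type*} [MeasurableSpace Ω] (S : ℕ → Ω → Finset N) : Prop :=
  ∀ t (A : Finset N), MeasurableSet {ω | S t ω = A}

/-- The long-run expected time-average utility. -/
def avgUtility {N Ω : Type*} [MeasurableSpace Ω] (f : Finset N → ℝ) (P : Measure Ω)
    (S : ℕ → Ω → Finset N) : ℝ :=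
  liminf (fun T : ℕ => (1 / (T : ℝ)) * ∑ t ∈ Finset.range T, ∫ ω, f (S t ω) ∂P) atTop

/-- The long-run expected fraction of rounds in which `u` is selected. -/
def selectionFraction {N Ω : Type*} [DecidableEq N] [MeasurableSpace Ω] (P : Measure Ω)
    (S : ℕ → Ω → Finset N) (u : N) : ℝ :=
  liminf (fun T : ℕ => (1 / (T : ℝ)) * ∑ t ∈ Finset.range T,
    ∫ ω, (if u ∈ S t ω then (1 : ℝ) else 0) ∂P) atTop

/-- The random sequence `S` selects at most `k` elements in every round and satisfies the fairness
requirement `r`. -/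
def IsFeasibleSeq {N Ω : Type*} [DecidableEq N] [MeasurableSpace Ω] (k : ℕ) (r : N → ℝ)
    (P : Measure Ω) (S : ℕ → Ω → Finset N) : Prop :=
  IsRandomSeq S ∧ (∀ t ω, (S t ω).card ≤ k) ∧ ∀ u, r u ≤ selectionFraction P S u

/-- The fairness requirement `r` is feasible: some algorithm satisfies it. -/
def IsFeasible {N : Type*} [DecidableEq N] (k : ℕ) (r : N → ℝ) : Prop :=
  ∃ (Ω : Type) (_ : MeasurableSpace Ω) (P : Measure Ω) (_ : IsProbabilityMeasure P)
    (S : ℕ → Ω → Finset N), IsFeasibleSeq k r P S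

/-- The supremum of the long-run expected time-average utility over all feasible algorithms. -/
def optUtility {N : Type*} [DecidableEq N] (f : Finset N → ℝ) (k : ℕ) (r : N → ℝ) : ℝ :=
  sSup {v : ℝ | ∃ (Ω : Type) (_ : MeasurableSpace Ω) (P : Measure Ω) (_ : IsProbabilityMeasure P)
    (S : ℕ → Ω → Finset N), IsFeasibleSeq k r P S ∧ v = avgUtility f P S}

/-! ### First step of the algorithm: the continuous greedy path -/

/-- The weight `F (y ∨ 1_u) - F y` of the element `u` at `y`. -/
def weight {N : Type*} [Fintype N] [DecidableEq N] (f : Finset N → ℝ) (y : N → ℝ) (u : N) : ℝ :=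
  multilinearExt f (y ⊔ Pi.single u 1) - multilinearExt f y

/-- `x` is an admissible direction at `y`: it maximizes the linear form with coefficients
`weight f y` over the polytope, and it is one of the maximizers with coordinate sum `k`
(the weights are nonnegative, so such maximizers exist). -/
def IsGreedyDirection {N : Type*} [Fintype N] [DecidableEq N] (f : Finset N → ℝ) (k : ℕ)
    (r y x : N → ℝ) : Prop :=
  x ∈ polytope k r ∧ (∀ z ∈ polytope k r, ∑ u, z u * weight f y u ≤ ∑ u, x u * weight f y u) ∧
    ∑ u, x u = (k : ℝ)

/-- The path `y` on `[0, 1]` starts at `r` and moves at rate `x τ - r` at time `τ`, where `x τ` is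
an admissible direction at `y τ`. The equation of motion is in integrated form because `x` may
jump. -/
structure IsGreedyPath {N : Type*} [Fintype N] [DecidableEq N] (f : Finset N → ℝ) (k : ℕ)
    (r : N → ℝ) (x y : ℝ → N → ℝ) : Prop where
  integrable : ∀ u, IntervalIntegrable (fun τ => x τ u) volume 0 1
  greedy : ∀ τ ∈ Set.Ico (0 : ℝ) 1, IsGreedyDirection f k r (y τ) (x τ)
  motion : ∀ τ ∈ Set.Icc (0 : ℝ) 1, ∀ u, y τ u = r u + ∫ s in (0 : ℝ)..τ, (x s u - r u)

/-! ### Second step of the algorithm: randomized dependent rounding -/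

/-- The coordinate of `u` is fractional. -/
def IsFloating {N : Type*} (y : N → ℝ) (u : N) : Prop := 0 < y u ∧ y u < 1

/-- The amount by which `y u` can be raised and `y v` lowered. -/
def stepUp {N : Type*} (y : N → ℝ) (u v : N) : ℝ := min (1 - y u) (y v)

/-- The amount by which `y u` can be lowered and `y v` raised. -/
def stepDown {N : Type*} (y : N → ℝ) (u v : N) : ℝ := min (y u) (1 - y v)

/-- Add `a` to the coordinate `u` and subtract it from the coordinate `v`. -/
def shift {N : Type*} [DecidableEq N] (y : N → ℝ) (u v : N) (a : ℝ) : N → ℝ :=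
  fun i => y i + a * ((if i = u then 1 else 0) - if i = v then 1 else 0)

open Classical in
/-- The set of the elements whose coordinate is `1`. -/
def onesOf {N : Type*} [Fintype N] (y : N → ℝ) : Finset N :=
  Finset.univ.filter fun u => y u = 1

/-- `DepRoundingLaw y μ`: the probability mass function `μ` is the law of the set returned by
dependent rounding from the input `y`, for some rule for finding the pair of fractional elements
in each iteration. The rule may depend on the history and may be randomized: in the current
iteration it finds the pair `e` with probability `q e` (a deterministic rule has `q e = 1` for
one pair). -/
inductive DepRoundingLaw {N : Type*} [Fintype N] [DecidableEq N] :
    (N → ℝ) → (Finset N → ℝ) → Prop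
  | done (y : N → ℝ) (hy : ∀ u, ¬ IsFloating y u) :
      DepRoundingLaw y (fun A => if A = onesOf y then 1 else 0)
  | step (y : N → ℝ) (q : N × N → ℝ) (hq0 : ∀ e, 0 ≤ q e) (hq1 : ∑ e, q e = 1)
      (hq : ∀ e, q e ≠ 0 → e.1 ≠ e.2 ∧ IsFloating y e.1 ∧ IsFloating y e.2)
      (μ ν : N × N → Finset N → ℝ)
      (hμ : ∀ e, q e ≠ 0 → DepRoundingLaw (shift y e.1 e.2 (stepUp y e.1 e.2)) (μ e))
      (hν : ∀ e, q e ≠ 0 → DepRoundingLaw (shift y e.1 e.2 (-stepDown y e.1 e.2)) (ν e)) :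
      DepRoundingLaw y (fun A => ∑ e, q e *
        (stepDown y e.1 e.2 / (stepUp y e.1 e.2 + stepDown y e.1 e.2) * μ e A +
          stepUp y e.1 e.2 / (stepUp y e.1 e.2 + stepDown y e.1 e.2) * ν e A))

/-- A run of the algorithm: a greedy path `y`, and in each round a random set obtained by
dependent rounding of the end point `y 1`. (Joint independence of the rounds is not needed.) -/
structure IsFairCG2Run {N Ω : Type*} [Fintype N] [DecidableEq N] [MeasurableSpace Ω]
    (f : Finset N → ℝ) (k : ℕ) (r : N → ℝ) (x y : ℝ → N → ℝ) (P : Measure Ω)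
    (S : ℕ → Ω → Finset N) : Prop where
  path : IsGreedyPath f k r x y
  randomSeq : IsRandomSeq S
  rounding : ∀ t, DepRoundingLaw (y 1) (fun A => P.real {ω | S t ω = A})

/-- The constant `1 - max (max_u r_u) ((∑ u, r_u) / k)`. -/
def rate {N : Type*} [Fintype N] (k : ℕ) (r : N → ℝ) : ℝ :=
  1 - max (⨆ u, r u) ((∑ u, r u) / (k : ℝ))

end

end FairCG

/-! Write `c` for `rate k r` and `w` for the weights at `y`. For a random set `R` that contains each
`u` independently with probability `y u`, submodularity gives `f A ≤ f R + ∑ u ∈ A, (f (insert u R)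
- f R)`; taking expectations, `f A ≤ F y + ∑ u ∈ A, w u`. This is linear in the indicator of `A`.
The time-averaged marginals of a feasible sequence accumulate in the polytope, so the optimum `U` is
at most `F y + ⟨x, w⟩` for the greedy direction `x` (`optUtility_le`). The path moves along `x - r`,
not `x`. The polytope also contains `r / (1 - c)` when `c < 1`, so optimality of `x` bounds `⟨r, w⟩`
by `(1 - c) * ⟨x, w⟩`, and hence `c * ⟨x, w⟩ ≤ ⟨x - r, w⟩` (`rate_mul_le_sum_sub_mul`). Since `w ≤
∇F` and `x ≥ r`, the derivative of `F` along the path is at least `c * (U - F)`, and Grönwall bounds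
`F (y 1)` from below. Rounding loses nothing in expectation: `F` is convex along differences of two
basis vectors and each rounding step preserves the mean (`DepRoundingLaw.multilinearExt_le`). -/

namespace FairCG

/-! ### Multilinear extension: affine slices and derivatives. -/

section Multilinear

theorem sup_single_one {N : Type*} [DecidableEq N] {y : N → ℝ} (hy0 : ∀ u, 0 ≤ y u) (hy1 : ∀ u, y u ≤ 1) (u : N) :
    y ⊔ Pi.single u 1 = Function.update y u 1 := by
  ext v
  by_cases h : v = u
  · subst h
    simp [hy1]
  · simp [h, hy0]

variable {N : Type*} [Fintype N] [DecidableEq N]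

theorem multilinearExt_eq_sum_erase (f : Finset N → ℝ) (y : N → ℝ) (u : N) :
    multilinearExt f y = ∑ S ∈ (Finset.univ.erase u).powerset,
      (f S * (1 - y u) + f (insert u S) * y u) *
        ((∏ v ∈ S, y v) * ∏ v ∈ Finset.univ.erase u \ S, (1 - y v)) := by
  have hu : u ∉ Finset.univ.erase u := Finset.notMem_erase u _
  have hins : insert u (Finset.univ.erase u) = Finset.univ :=
    Finset.insert_erase (Finset.mem_univ u)
  rw [multilinearExt, ← Finset.powerset_univ, ← hins, Finset.sum_powerset_insert hu,
    ← Finset.sum_add_distrib, hins]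
  refine Finset.sum_congr rfl fun S hS => ?_
  have huS : u ∉ S := fun h => hu (Finset.mem_powerset.mp hS h)
  have h1 : Sᶜ = insert u (Finset.univ.erase u \ S) := by
    ext v
    by_cases hv : v = u <;> simp [hv, huS]
  have h2 : (insert u S)ᶜ = Finset.univ.erase u \ S := by
    ext v
    simp
  rw [h1, h2, Finset.prod_insert (by simp), Finset.prod_insert huS]
  ring

/-- Conditioning on whether the random set contains `u`. The two set functions on the right ignore
membership of `u`, so their extensions do not depend on `y u`. -/
theorem multilinearExt_update (f : Finset N → ℝ) (y : N → ℝ) (u : N) (a : ℝ) :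
    multilinearExt f (Function.update y u a) =
      (1 - a) * multilinearExt (fun S => f (S.erase u)) y +
        a * multilinearExt (fun S => f (insert u S)) y := by
  rw [multilinearExt_eq_sum_erase f _ u, multilinearExt_eq_sum_erase _ y u,
    multilinearExt_eq_sum_erase _ y u, Finset.mul_sum, Finset.mul_sum, ← Finset.sum_add_distrib]
  refine Finset.sum_congr rfl fun S hS => ?_
  have hS' := Finset.mem_powerset.mp hS
  have huS : u ∉ S := fun h => Finset.notMem_erase u _ (hS' h)
  have h1 : ∏ v ∈ S, Function.update y u a v = ∏ v ∈ S, y v :=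
    Finset.prod_congr rfl fun v hv =>
      Function.update_of_ne (ne_of_mem_of_not_mem hv huS) _ _
  have h2 : ∏ v ∈ Finset.univ.erase u \ S, (1 - Function.update y u a v) =
      ∏ v ∈ Finset.univ.erase u \ S, (1 - y v) :=
    Finset.prod_congr rfl fun v hv => by
      rw [Function.update_of_ne (Finset.ne_of_mem_erase (Finset.mem_sdiff.mp hv).1)]
  rw [h1, h2, Function.update_self, Finset.erase_eq_of_notMem huS, Finset.erase_insert huS,
    Finset.insert_idem]
  ring

theorem multilinearExt_const (c : ℝ) (y : N → ℝ) : multilinearExt (fun _ => c) y = c := by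
  rw [multilinearExt, ← Finset.mul_sum, ← Fintype.prod_add]
  simp

theorem multilinearExt_add (f g : Finset N → ℝ) (y : N → ℝ) :
    multilinearExt (fun S => f S + g S) y = multilinearExt f y + multilinearExt g y := by
  simp only [multilinearExt, add_mul, Finset.sum_add_distrib]

theorem multilinearExt_sub (f g : Finset N → ℝ) (y : N → ℝ) :
    multilinearExt (fun S => f S - g S) y = multilinearExt f y - multilinearExt g y := by
  simp only [multilinearExt, sub_mul, Finset.sum_sub_distrib]

theorem multilinearExt_sum {ι : Type*} (s : Finset ι) (f : ι → Finset N → ℝ) (y : N → ℝ) :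
    multilinearExt (fun S => ∑ i ∈ s, f i S) y = ∑ i ∈ s, multilinearExt (f i) y := by
  simp only [multilinearExt, Finset.sum_mul]
  exact Finset.sum_comm

theorem multilinearExt_le_of_le {f g : Finset N → ℝ} (h : ∀ S, f S ≤ g S) {y : N → ℝ}
    (hy0 : ∀ u, 0 ≤ y u) (hy1 : ∀ u, y u ≤ 1) : multilinearExt f y ≤ multilinearExt g y :=
  Finset.sum_le_sum fun S _ => mul_le_mul_of_nonneg_right (h S) <|
    mul_nonneg (Finset.prod_nonneg fun u _ => hy0 u)
      (Finset.prod_nonneg fun u _ => sub_nonneg.mpr (hy1 u))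

theorem multilinearExt_of_integral (f : Finset N → ℝ) {y : N → ℝ} (hy : ∀ u, y u = 0 ∨ y u = 1) :
    multilinearExt f y = f (onesOf y) := by
  have hmem : ∀ u, u ∈ onesOf y ↔ y u = 1 := fun u => by simp [onesOf]
  rw [multilinearExt, Finset.sum_eq_single (onesOf y)]
  · rw [Finset.prod_eq_one fun u hu => (hmem u).mp hu, Finset.prod_eq_one fun u hu => ?_]
    · ring
    · have h1 : y u ≠ 1 := fun h => Finset.mem_compl.mp hu ((hmem u).mpr h)
      rw [(hy u).resolve_right h1, sub_zero]
  · intro S _ hS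
    by_cases hsub : S ⊆ onesOf y
    · obtain ⟨u, hu, huS⟩ := Finset.exists_of_ssubset (hsub.ssubset_of_ne hS)
      rw [Finset.prod_eq_zero (Finset.mem_compl.mpr huS) (by rw [(hmem u).mp hu, sub_self])]
      ring
    · obtain ⟨u, huS, hu⟩ := Finset.not_subset.mp hsub
      rw [Finset.prod_eq_zero huS ((hy u).resolve_right fun h => hu ((hmem u).mpr h))]
      ring
  · simp

theorem differentiable_multilinearExt (f : Finset N → ℝ) :
    Differentiable ℝ (multilinearExt f) := by
  unfold multilinearExt
  fun_prop

/-- The partial derivative of the multilinear extension: the expected gain from `u`. -/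
noncomputable def partialExt (f : Finset N → ℝ) (y : N → ℝ) (u : N) : ℝ :=
  multilinearExt (fun S => f (insert u S)) y - multilinearExt (fun S => f (S.erase u)) y

theorem fderiv_multilinearExt_single (f : Finset N → ℝ) (y : N → ℝ) (u : N) :
    fderiv ℝ (multilinearExt f) y (Pi.single u 1) = partialExt f y u := by
  have h1 : HasDerivAt (fun a => multilinearExt f (Function.update y u a))
      (fderiv ℝ (multilinearExt f) y (Pi.single u 1)) (y u) := by
    have := (differentiable_multilinearExt f (Function.update y u (y u))).hasFDerivAt.comp_hasDerivAt
      (y u) (hasDerivAt_update y u (y u))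
    rwa [Function.update_eq_self] at this
  have h2 : HasDerivAt (fun a => multilinearExt f (Function.update y u a))
      (partialExt f y u) (y u) := by
    simp only [multilinearExt_update]
    have h := (((hasDerivAt_id (y u)).const_sub 1).mul_const
      (multilinearExt (fun S => f (S.erase u)) y)).add
      ((hasDerivAt_id (y u)).mul_const (multilinearExt (fun S => f (insert u S)) y))
    exact h.congr_deriv (by rw [partialExt]; ring)
  exact h1.unique h2

theorem hasDerivAt_multilinearExt_comp (f : Finset N → ℝ) {Y : ℝ → N → ℝ} {d : N → ℝ} {τ : ℝ}
    (h : ∀ u, HasDerivAt (fun s => Y s u) (d u) τ) :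
    HasDerivAt (fun s => multilinearExt f (Y s)) (∑ u, d u * partialExt f (Y τ) u) τ := by
  have h1 := (differentiable_multilinearExt f (Y τ)).hasFDerivAt.comp_hasDerivAt τ
    (hasDerivAt_pi.mpr h)
  refine h1.congr_deriv ?_
  have hd : d = ∑ u, d u • Pi.single u (1 : ℝ) := by
    ext v
    simp [Pi.single_apply]
  conv_lhs => rw [hd, map_sum]
  refine Finset.sum_congr rfl fun u _ => ?_
  rw [map_smul, smul_eq_mul, fderiv_multilinearExt_single]

theorem weight_eq_sub (f : Finset N → ℝ) {y : N → ℝ} (hy0 : ∀ u, 0 ≤ y u) (hy1 : ∀ u, y u ≤ 1)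
    (u : N) : weight f y u = multilinearExt (fun S => f (insert u S)) y - multilinearExt f y := by
  rw [weight, sup_single_one hy0 hy1, multilinearExt_update]
  ring

theorem weight_eq_mul_partialExt (f : Finset N → ℝ) {y : N → ℝ} (hy0 : ∀ u, 0 ≤ y u)
    (hy1 : ∀ u, y u ≤ 1) (u : N) : weight f y u = (1 - y u) * partialExt f y u := by
  have h := multilinearExt_update f y u (y u)
  rw [Function.update_eq_self] at h
  rw [weight_eq_sub f hy0 hy1, partialExt, h]
  ring

/-- The weight is `1 - y u` times the partial derivative, which is nonnegative by monotonicity. -/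
theorem weight_le_partialExt {f : Finset N → ℝ} (hf : Monotone f) {y : N → ℝ} (hy0 : ∀ u, 0 ≤ y u)
    (hy1 : ∀ u, y u ≤ 1) (u : N) : weight f y u ≤ partialExt f y u := by
  have h : 0 ≤ partialExt f y u := sub_nonneg.mpr <| multilinearExt_le_of_le
    (fun S => hf ((Finset.erase_subset u S).trans (Finset.subset_insert u S))) hy0 hy1
  rw [weight_eq_mul_partialExt f hy0 hy1]
  nlinarith [hy0 u]

end Multilinear

/-! ### Consequences of submodularity. -/

section Submodular

variable {N : Type*} [DecidableEq N]

/-- Add the elements of `A` to `R` one at a time; each gain is at most the gain over `R` alone. -/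
theorem IsSubmodular.le_add_sum {f : Finset N → ℝ} (hf : Monotone f) (hs : IsSubmodular f)
    (A R : Finset N) : f A ≤ f R + ∑ u ∈ A, (f (insert u R) - f R) := by
  refine (hf (Finset.subset_union_left (s₂ := R))).trans ?_
  induction A using Finset.induction_on with
  | empty => simp
  | insert a A ha ih =>
    rw [Finset.sum_insert ha, Finset.insert_union]
    have h : f (insert a (A ∪ R)) - f (A ∪ R) ≤ f (insert a R) - f R := by
      by_cases hmem : a ∈ A ∪ R
      · rw [Finset.insert_eq_of_mem hmem, sub_self, sub_nonneg]
        exact hf (Finset.subset_insert a R)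
      · exact hs R (A ∪ R) Finset.subset_union_right a hmem
    linarith

theorem IsSubmodular.le_multilinearExt_add_sum [Fintype N] {f : Finset N → ℝ} (hf : Monotone f)
    (hs : IsSubmodular f) {y : N → ℝ} (hy0 : ∀ u, 0 ≤ y u) (hy1 : ∀ u, y u ≤ 1) (A : Finset N) :
    f A ≤ multilinearExt f y + ∑ u ∈ A, weight f y u := by
  have h := multilinearExt_le_of_le (hs.le_add_sum hf A) hy0 hy1
  rw [multilinearExt_const, multilinearExt_add, multilinearExt_sum] at h
  simpa only [multilinearExt_sub, ← weight_eq_sub f hy0 hy1] using h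

/-- `A`, `B`, `C`, `D` are the expected values when the random set is forced to contain neither
element, only `u`, only `v`, or both. The inequality says that the mixed second derivative is
nonpositive. -/
theorem IsSubmodular.exists_bilinear [Fintype N] {f : Finset N → ℝ} (hs : IsSubmodular f)
    {y : N → ℝ} (hy0 : ∀ u, 0 ≤ y u) (hy1 : ∀ u, y u ≤ 1) {u v : N} (huv : u ≠ v) :
    ∃ A B C D : ℝ, A + D ≤ B + C ∧
      ∀ s t, multilinearExt f (Function.update (Function.update y u s) v t) =
        (1 - t) * ((1 - s) * A + s * B) + t * ((1 - s) * C + s * D) := by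
  refine ⟨_, _, _, _, ?_, fun s t => by
    rw [multilinearExt_update, multilinearExt_update, multilinearExt_update]⟩
  rw [← multilinearExt_add, ← multilinearExt_add]
  refine multilinearExt_le_of_le (fun S => ?_) hy0 hy1
  have h := hs ((S.erase u).erase v) (insert v ((S.erase u).erase v)) (Finset.subset_insert _ _) u
    (by simp [huv])
  have e1 : insert u (insert v ((S.erase u).erase v)) = insert v (insert u S) := by grind
  have e2 : insert u ((S.erase u).erase v) = (insert u S).erase v := by grind
  have e3 : insert v ((S.erase u).erase v) = insert v (S.erase u) := by grind
  rw [e1, e2, e3] at h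
  linarith

end Submodular

/-! ### Dependent rounding does not decrease the expected value. -/

section Rounding

variable {N : Type*}

theorem shift_eq_update [DecidableEq N] (y : N → ℝ) {u v : N} (huv : u ≠ v) (a : ℝ) :
    shift y u v a = Function.update (Function.update y u (y u + a)) v (y v - a) := by
  ext w
  by_cases hv : w = v
  · subst hv
    simp [shift, huv.symm]
    ring
  · by_cases hu : w = u
    · subst hu
      simp [shift, huv]
    · simp [shift, hu, hv]

theorem stepUp_pos {y : N → ℝ} {u v : N} (hu : IsFloating y u) (hv : IsFloating y v) :
    0 < stepUp y u v :=
  lt_min (sub_pos.mpr hu.2) hv.1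

theorem stepDown_pos {y : N → ℝ} {u v : N} (hu : IsFloating y u) (hv : IsFloating y v) :
    0 < stepDown y u v :=
  lt_min hu.1 (sub_pos.mpr hv.2)

theorem shift_mem_cube [DecidableEq N] {y : N → ℝ} (hy : ∀ w, y w ∈ Set.Icc (0 : ℝ) 1) {u v : N} (huv : u ≠ v)
    {a : ℝ} (hu : y u + a ∈ Set.Icc (0 : ℝ) 1) (hv : y v - a ∈ Set.Icc (0 : ℝ) 1) (w : N) :
    shift y u v a w ∈ Set.Icc (0 : ℝ) 1 := by
  rw [shift_eq_update y huv]
  by_cases h : w = v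
  · subst h
    simpa using hv
  · by_cases h' : w = u
    · subst h'
      simpa [h] using hu
    · simpa [h, h'] using hy w

/-- Raising `y u` while lowering `y v` equally turns the nonpositive mixed derivative into
convexity; the two outcomes average to `y`, so this is Jensen's inequality. -/
theorem multilinearExt_le_rounding_step [Fintype N] [DecidableEq N] {f : Finset N → ℝ}
    (hs : IsSubmodular f) {y : N → ℝ} (hy0 : ∀ u, 0 ≤ y u) (hy1 : ∀ u, y u ≤ 1) {u v : N} (huv : u ≠ v) {a b : ℝ}
    (ha : 0 < a) (hb : 0 < b) :
    multilinearExt f y ≤ b / (a + b) * multilinearExt f (shift y u v a) +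
      a / (a + b) * multilinearExt f (shift y u v (-b)) := by
  obtain ⟨A, B, C, D, hABCD, h⟩ := hs.exists_bilinear hy0 hy1 huv
  have h0 := h (y u) (y v)
  rw [Function.update_eq_self, Function.update_eq_self] at h0
  rw [shift_eq_update y huv, shift_eq_update y huv, h, h, h0]
  have hab : 0 < a + b := add_pos ha hb
  rw [div_mul_eq_mul_div, div_mul_eq_mul_div, ← add_div, le_div_iff₀ hab]
  -- This is exactly the Jensen gap multiplied by `a + b`: the linear terms cancel.
  have : 0 ≤ (a * b * (a + b)) * (B + C - A - D) := by
    have : 0 ≤ B + C - A - D := by linarith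
    positivity
  linarith

theorem DepRoundingLaw.multilinearExt_le [Fintype N] [DecidableEq N] {f : Finset N → ℝ}
    (hs : IsSubmodular f) {y : N → ℝ} {μ : Finset N → ℝ} (hμ : DepRoundingLaw y μ) (hy : ∀ u, y u ∈ Set.Icc (0 : ℝ) 1) :
    multilinearExt f y ≤ ∑ A, μ A * f A := by
  induction hμ with
  | done y hfl =>
    have h01 : ∀ u, y u = 0 ∨ y u = 1 := fun u => by
      by_contra! h
      exact hfl u ⟨(hy u).1.lt_of_ne h.1.symm, (hy u).2.lt_of_ne h.2⟩
    rw [multilinearExt_of_integral f h01]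
    simp
  | step y q hq0 hq1 hq μ ν _ _ ihμ ihν =>
    have hswap : ∀ g : N × N → Finset N → ℝ,
        ∑ A, (∑ e, q e * g e A) * f A = ∑ e, q e * ∑ A, g e A * f A := fun g => by
      simp only [Finset.sum_mul, Finset.mul_sum]
      rw [Finset.sum_comm]
      simp only [mul_assoc]
    rw [hswap]
    calc multilinearExt f y = ∑ e, q e * multilinearExt f y := by
          rw [← Finset.sum_mul, hq1, one_mul]
      _ ≤ _ := Finset.sum_le_sum fun e _ => ?_
    rcases eq_or_ne (q e) 0 with h0 | h0
    · simp [h0]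
    obtain ⟨hne, hu, hv⟩ := hq e h0
    refine mul_le_mul_of_nonneg_left ?_ (hq0 e)
    have ha := stepUp_pos hu hv
    have hb := stepDown_pos hu hv
    have ha1 : stepUp y e.1 e.2 ≤ 1 - y e.1 := min_le_left _ _
    have ha2 : stepUp y e.1 e.2 ≤ y e.2 := min_le_right _ _
    have hb1 : stepDown y e.1 e.2 ≤ y e.1 := min_le_left _ _
    have hb2 : stepDown y e.1 e.2 ≤ 1 - y e.2 := min_le_right _ _
    have h1 := ihμ e h0 (shift_mem_cube hy hne
      ⟨by linarith [hu.1], by linarith⟩ ⟨by linarith, by linarith [hv.2]⟩)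
    have h2 := ihν e h0 (shift_mem_cube hy hne
      ⟨by linarith, by linarith [hu.2]⟩ ⟨by linarith [hv.1], by linarith⟩)
    refine (multilinearExt_le_rounding_step hs (fun u => (hy u).1) (fun u => (hy u).2) hne ha
      hb).trans ?_
    simp only [add_mul, mul_assoc, Finset.sum_add_distrib, ← Finset.mul_sum]
    gcongr

end Rounding

/-! ### Long-run averages and the linear upper bound on the optimum. -/

section LongRun

theorem comp_eq_sum_indicator {N Ω : Type*} [Fintype N] [DecidableEq N] (X : Ω → Finset N)
    (g : Finset N → ℝ) :
    (fun ω => g (X ω)) = fun ω => ∑ A, ({ω | X ω = A}).indicator (fun _ => g A) ω := by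
  ext ω
  rw [Finset.sum_eq_single (X ω)]
  · simp
  · intro A _ hA
    exact Set.indicator_of_notMem (fun h => hA h.symm) _
  · simp

variable {N Ω : Type*} [MeasurableSpace Ω] {P : Measure Ω} {S : ℕ → Ω → Finset N}

/-- The expected average of `g` over the first `T` sets of the sequence. -/
noncomputable def timeAvg (P : Measure Ω) (S : ℕ → Ω → Finset N) (g : Finset N → ℝ) (T : ℕ) : ℝ :=
  (1 / (T : ℝ)) * ∑ t ∈ Finset.range T, ∫ ω, g (S t ω) ∂P

theorem timeAvg_const [IsProbabilityMeasure P] (c : ℝ) {T : ℕ} (hT : T ≠ 0) :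
    timeAvg P S (fun _ => c) T = c := by
  have : (T : ℝ) ≠ 0 := Nat.cast_ne_zero.mpr hT
  simp [timeAvg]
  field_simp

theorem timeAvg_mul_const (g : Finset N → ℝ) (c : ℝ) (T : ℕ) :
    timeAvg P S (fun A => g A * c) T = timeAvg P S g T * c := by
  simp only [timeAvg, integral_mul_const, ← Finset.sum_mul, mul_assoc]

variable [Fintype N]

theorem IsRandomSeq.integrable [IsFiniteMeasure P] (hS : IsRandomSeq S) (g : Finset N → ℝ)
    (t : ℕ) : Integrable (fun ω => g (S t ω)) P := by
  classical
  rw [comp_eq_sum_indicator]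
  exact integrable_finsetSum _ fun A _ => (integrable_const _).indicator (hS t A)

theorem IsRandomSeq.integral_eq_sum [IsFiniteMeasure P] (hS : IsRandomSeq S) (g : Finset N → ℝ)
    (t : ℕ) : ∫ ω, g (S t ω) ∂P = ∑ A, P.real {ω | S t ω = A} * g A := by
  classical
  rw [comp_eq_sum_indicator, integral_finsetSum _ fun A _ =>
    (integrable_const _).indicator (hS t A)]
  exact Finset.sum_congr rfl fun A _ => integral_indicator_const _ (hS t A)

theorem IsRandomSeq.integral_mono [IsFiniteMeasure P] (hS : IsRandomSeq S) {g h : Finset N → ℝ}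
    (t : ℕ) (hgh : ∀ ω, g (S t ω) ≤ h (S t ω)) : ∫ ω, g (S t ω) ∂P ≤ ∫ ω, h (S t ω) ∂P :=
  MeasureTheory.integral_mono (hS.integrable g t) (hS.integrable h t) hgh

theorem IsRandomSeq.timeAvg_mono [IsFiniteMeasure P] (hS : IsRandomSeq S) {g h : Finset N → ℝ}
    (hgh : ∀ t ω, g (S t ω) ≤ h (S t ω)) (T : ℕ) : timeAvg P S g T ≤ timeAvg P S h T :=
  mul_le_mul_of_nonneg_left (Finset.sum_le_sum fun t _ => hS.integral_mono t (hgh t)) (by positivity)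

theorem IsRandomSeq.timeAvg_add [IsFiniteMeasure P] (hS : IsRandomSeq S) (g h : Finset N → ℝ)
    (T : ℕ) : timeAvg P S (fun A => g A + h A) T = timeAvg P S g T + timeAvg P S h T := by
  simp only [timeAvg, integral_add (hS.integrable g _) (hS.integrable h _),
    Finset.sum_add_distrib, mul_add]

theorem IsRandomSeq.timeAvg_sum [IsFiniteMeasure P] (hS : IsRandomSeq S) {ι : Type*}
    (s : Finset ι) (g : ι → Finset N → ℝ) (T : ℕ) :
    timeAvg P S (fun A => ∑ i ∈ s, g i A) T = ∑ i ∈ s, timeAvg P S (g i) T := by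
  simp only [timeAvg, integral_finsetSum _ fun i _ => hS.integrable (g i) _]
  rw [Finset.sum_comm, Finset.mul_sum]

theorem IsRandomSeq.timeAvg_le [IsProbabilityMeasure P] (hS : IsRandomSeq S) {g : Finset N → ℝ}
    {c : ℝ} (hg : ∀ t ω, g (S t ω) ≤ c) {T : ℕ} (hT : T ≠ 0) : timeAvg P S g T ≤ c :=
  (hS.timeAvg_mono (h := fun _ => c) hg T).trans_eq (timeAvg_const c hT)

theorem IsRandomSeq.le_timeAvg [IsProbabilityMeasure P] (hS : IsRandomSeq S) {g : Finset N → ℝ}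
    {c : ℝ} (hg : ∀ t ω, c ≤ g (S t ω)) {T : ℕ} (hT : T ≠ 0) : c ≤ timeAvg P S g T :=
  (timeAvg_const c hT).symm.trans_le (hS.timeAvg_mono (g := fun _ => c) hg T)

/-- A `liminf` in `ℝ` takes a default value without bounds; finiteness of the ground set supplies
them. -/
theorem IsRandomSeq.isBoundedUnder_ge [IsProbabilityMeasure P] (hS : IsRandomSeq S)
    (g : Finset N → ℝ) : IsBoundedUnder (· ≥ ·) atTop (timeAvg P S g) := by
  refine isBoundedUnder_of_eventually_ge (a := -∑ A, |g A|) ?_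
  filter_upwards [eventually_ne_atTop 0] with T hT
  refine hS.le_timeAvg (fun t ω => ?_) hT
  exact neg_le_of_abs_le (Finset.single_le_sum (f := fun A => |g A|) (fun _ _ => abs_nonneg _)
    (Finset.mem_univ (S t ω)))

theorem IsRandomSeq.isBoundedUnder_le [IsProbabilityMeasure P] (hS : IsRandomSeq S)
    (g : Finset N → ℝ) : IsBoundedUnder (· ≤ ·) atTop (timeAvg P S g) := by
  refine isBoundedUnder_of_eventually_le (a := ∑ A, |g A|) ?_
  filter_upwards [eventually_ne_atTop 0] with T hT
  refine hS.timeAvg_le (fun t ω => ?_) hT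
  exact le_of_abs_le (Finset.single_le_sum (f := fun A => |g A|) (fun _ _ => abs_nonneg _)
    (Finset.mem_univ (S t ω)))

/-- The marginals of the average of the first rounds accumulate in the polytope, so a linear upper
bound on the polytope bounds the long-run utility. -/
theorem IsFeasibleSeq.avgUtility_le [DecidableEq N] [IsProbabilityMeasure P] {f : Finset N → ℝ}
    {k : ℕ} {r : N → ℝ} (hS : IsFeasibleSeq k r P S) {w : N → ℝ} {c B : ℝ}
    (hf : ∀ A, f A ≤ c + ∑ u ∈ A, w u) (hB : ∀ z ∈ polytope k r, ∑ u, z u * w u ≤ B) :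
    avgUtility f P S ≤ c + B := by
  obtain ⟨hrand, hcard, hfrac⟩ := hS
  by_contra! hlt
  obtain ⟨b, hb, hbU⟩ := exists_between hlt
  let ind : N → Finset N → ℝ := fun u A => if u ∈ A then 1 else 0
  let z : ℕ → N → ℝ := fun T u => timeAvg P S (ind u) T
  have hU : ∀ᶠ T in atTop, b < timeAvg P S f T :=
    eventually_lt_of_lt_liminf hbU (hrand.isBoundedUnder_ge f)
  have hbz : ∀ᶠ T in atTop, b - c < ∑ u, z T u * w u := by
    filter_upwards [hU, eventually_ne_atTop 0] with T hT hT0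
    have h := hrand.timeAvg_mono (P := P) (g := f) (h := fun A => c + ∑ u, ind u A * w u)
      (fun t ω => (hf _).trans_eq (by simp [ind, Finset.sum_ite_mem])) T
    rw [hrand.timeAvg_add, timeAvg_const c hT0, hrand.timeAvg_sum] at h
    simp only [timeAvg_mul_const] at h
    linarith
  have hz : ∀ᶠ T in atTop, z T ∈ Set.Icc (0 : N → ℝ) 1 := by
    filter_upwards [eventually_ne_atTop 0] with T hT0
    refine ⟨fun u => hrand.le_timeAvg (fun t ω => ?_) hT0,
      fun u => hrand.timeAvg_le (fun t ω => ?_) hT0⟩ <;>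
    · simp only [ind]
      split_ifs <;> norm_num
  have hzk : ∀ᶠ T in atTop, ∑ u, z T u ≤ k := by
    filter_upwards [eventually_ne_atTop 0] with T hT0
    have h := hrand.timeAvg_le (P := P) (g := fun A => ∑ u, ind u A) (c := k)
      (fun t ω => by simpa [ind] using hcard t ω) hT0
    rwa [hrand.timeAvg_sum] at h
  obtain ⟨T₀, hT₀⟩ := eventually_atTop.mp hz
  -- The shift by `T₀` puts every term in the compact cube; in particular `T = 0`, where `1 / 0 =
  -- 0`, needs no separate treatment.
  obtain ⟨z', hz', φ, hφ, hlim⟩ := isCompact_Icc.tendsto_subseq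
    (x := fun n => z (n + T₀)) (fun n => hT₀ _ (Nat.le_add_left _ _))
  have hψ : Tendsto (fun n => φ n + T₀) atTop atTop :=
    tendsto_atTop_mono (fun n => Nat.le_add_right _ _) hφ.tendsto_atTop
  have hlim' : ∀ u, Tendsto (fun n => z (φ n + T₀) u) atTop (nhds (z' u)) :=
    fun u => (tendsto_pi_nhds.mp hlim) u
  have hmem : z' ∈ polytope k r := by
    refine ⟨hz'.1, fun u => ?_, hz'.2, ?_⟩
    · refine le_of_forall_lt fun a ha => ?_
      obtain ⟨a', haa', ha'⟩ := exists_between ha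
      have h : ∀ᶠ T in atTop, a' < z T u := eventually_lt_of_lt_liminf
        (ha'.trans_le (hfrac u)) (hrand.isBoundedUnder_ge (ind u))
      exact haa'.trans_le (ge_of_tendsto (hlim' u) ((hψ.eventually h).mono fun _ h => h.le))
    · exact le_of_tendsto (tendsto_finsetSum _ fun u _ => hlim' u) (hψ.eventually hzk)
  have h1 : b - c ≤ ∑ u, z' u * w u :=
    ge_of_tendsto (tendsto_finsetSum _ fun u _ => (hlim' u).mul_const (w u))
      ((hψ.eventually hbz).mono fun _ h => h.le)
  linarith [hB z' hmem]

theorem optUtility_le [DecidableEq N] {f : Finset N → ℝ} {k : ℕ} {r : N → ℝ}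
    (hr : IsFeasible k r) {w : N → ℝ} {c B : ℝ} (hf : ∀ A, f A ≤ c + ∑ u ∈ A, w u)
    (hB : ∀ z ∈ polytope k r, ∑ u, z u * w u ≤ B) : optUtility f k r ≤ c + B := by
  obtain ⟨Ω', m, P', hP', S', hS'⟩ := hr
  -- Feasibility makes the set nonempty, as an upper bound on a real `sSup` requires here.
  refine csSup_le ⟨_, Ω', m, P', hP', S', hS', rfl⟩ ?_
  rintro v ⟨Ω₁, m₁, P₁, hP₁, S₁, hS₁, rfl⟩
  exact hS₁.avgUtility_le hf hB

theorem le_avgUtility [IsProbabilityMeasure P] (hS : IsRandomSeq S) {f : Finset N → ℝ} {c : ℝ}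
    (h : ∀ t, c ≤ ∫ ω, f (S t ω) ∂P) : c ≤ avgUtility f P S := by
  refine le_liminf_of_le (hS.isBoundedUnder_le f).isCoboundedUnder_ge ?_
  filter_upwards [eventually_ne_atTop 0] with T hT
  have hT' : (0 : ℝ) < T := by exact_mod_cast Nat.pos_of_ne_zero hT
  have h1 := Finset.sum_le_sum fun t (_ : t ∈ Finset.range T) => h t
  rw [Finset.sum_const, Finset.card_range, nsmul_eq_mul] at h1
  rw [one_div, le_inv_mul_iff₀ hT']
  exact h1

end LongRun

/-! ### Loss from moving along `x - r` instead of `x`. -/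

section Rate

variable {N : Type*} [Fintype N]

theorem IsGreedyDirection.sum_le [DecidableEq N] {f : Finset N → ℝ} {k : ℕ} {r y x : N → ℝ}
    (h : IsGreedyDirection f k r y x) : ∑ u, r u ≤ k :=
  (Finset.sum_le_sum fun u _ => h.1.2.1 u).trans_eq h.2.2

theorem one_sub_rate_le_one {k : ℕ} (hk : 1 ≤ k) {r : N → ℝ} (hr1 : ∀ u, r u ≤ 1)
    (hsum : ∑ u, r u ≤ k) : 1 - rate k r ≤ 1 := by
  have hk' : (0 : ℝ) < k := by exact_mod_cast hk
  rw [rate, sub_sub_cancel]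
  exact max_le (Real.iSup_le hr1 zero_le_one) ((div_le_one hk').mpr hsum)

/-- Scaling `r` up by `1 / (1 - rate k r)` stays in the polytope. -/
theorem inv_one_sub_rate_smul_mem_polytope {k : ℕ} (hk : 1 ≤ k) {r : N → ℝ} (hr0 : ∀ u, 0 ≤ r u)
    (hr1 : ∀ u, r u ≤ 1) (hsum : ∑ u, r u ≤ k) (hpos : 0 < 1 - rate k r) :
    (fun u => r u / (1 - rate k r)) ∈ polytope k r := by
  have hk' : (0 : ℝ) < k := by exact_mod_cast hk
  have hm1 := one_sub_rate_le_one hk hr1 hsum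
  have hrm : ∀ u, r u ≤ 1 - rate k r := fun u => by
    rw [rate, sub_sub_cancel]
    exact (le_ciSup (Set.finite_range r).bddAbove u).trans (le_max_left _ _)
  have hsm : ∑ u, r u ≤ k * (1 - rate k r) := by
    rw [rate, sub_sub_cancel, ← div_le_iff₀' hk']
    exact le_max_right _ _
  refine ⟨fun u => div_nonneg (hr0 u) hpos.le, fun u => ?_, fun u => (div_le_one hpos).mpr (hrm u),
    ?_⟩
  · exact (le_div_iff₀ hpos).mpr (mul_le_of_le_one_right (hr0 u) hm1)
  · rw [← Finset.sum_div, div_le_iff₀ hpos]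
    exact hsm

theorem rate_mul_le_sum_sub_mul {k : ℕ} (hk : 1 ≤ k) {r : N → ℝ} (hr0 : ∀ u, 0 ≤ r u)
    (hr1 : ∀ u, r u ≤ 1) (hsum : ∑ u, r u ≤ k) {x w : N → ℝ}
    (hx : ∀ z ∈ polytope k r, ∑ u, z u * w u ≤ ∑ u, x u * w u) :
    rate k r * ∑ u, x u * w u ≤ ∑ u, (x u - r u) * w u := by
  have hsub : ∑ u, (x u - r u) * w u = ∑ u, x u * w u - ∑ u, r u * w u := by
    simp only [sub_mul, Finset.sum_sub_distrib]
  suffices h : ∑ u, r u * w u ≤ (1 - rate k r) * ∑ u, x u * w u by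
    rw [hsub]
    linarith
  have hrm : ∀ u, r u ≤ 1 - rate k r := fun u => by
    rw [rate, sub_sub_cancel]
    exact (le_ciSup (Set.finite_range r).bddAbove u).trans (le_max_left _ _)
  have hm0 : 0 ≤ 1 - rate k r := by
    rw [rate, sub_sub_cancel]
    exact le_max_of_le_left (Real.iSup_nonneg hr0)
  -- If `1 - rate k r = 0`, then `r = 0` and nothing is lost; otherwise `r` scaled by its inverse
  -- competes with `x`.
  rcases hm0.eq_or_lt with h0 | hpos
  · have hz : ∀ u, r u = 0 := fun u => le_antisymm ((hrm u).trans_eq h0.symm) (hr0 u)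
    rw [← h0]
    simp [hz]
  · have h := hx _ (inv_one_sub_rate_smul_mem_polytope hk hr0 hr1 hsum hpos)
    simp only [div_mul_eq_mul_div, ← Finset.sum_div] at h
    rwa [div_le_iff₀' hpos] at h

end Rate

/-! ### The greedy path and its differential inequality. -/

section Path

variable {N : Type*} [Fintype N] [DecidableEq N] {f : Finset N → ℝ} {k : ℕ} {r : N → ℝ}
  {x y : ℝ → N → ℝ}

theorem IsGreedyPath.sum_le (h : IsGreedyPath f k r x y) : ∑ u, r u ≤ k :=
  (h.greedy 0 (by simp)).sum_le

theorem IsGreedyPath.intervalIntegrable (h : IsGreedyPath f k r x y) {τ : ℝ}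
    (hτ : τ ∈ Set.Icc (0 : ℝ) 1) (u : N) : IntervalIntegrable (fun s => x s u) volume 0 τ :=
  (h.integrable u).mono_set (by
    rw [Set.uIcc_of_le hτ.1, Set.uIcc_of_le zero_le_one]
    exact Set.Icc_subset_Icc_right hτ.2)

/-- The path is `y τ = (1 - τ) * r + ∫ x` over `[0, τ]`, an average of points of the polytope. -/
theorem IsGreedyPath.mem_polytope (h : IsGreedyPath f k r x y) (hr0 : ∀ u, 0 ≤ r u)
    (hr1 : ∀ u, r u ≤ 1) {τ : ℝ} (hτ : τ ∈ Set.Icc (0 : ℝ) 1) : y τ ∈ polytope k r := by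
  have hx : ∀ s ∈ Set.Ioo 0 τ, IsGreedyDirection f k r (y s) (x s) :=
    fun s hs => h.greedy s ⟨hs.1.le, hs.2.trans_le hτ.2⟩
  have hint := h.intervalIntegrable hτ
  have hmotion : ∀ u, y τ u = r u + ((∫ s in (0 : ℝ)..τ, x s u) - τ * r u) := fun u => by
    rw [h.motion τ hτ u, intervalIntegral.integral_sub (hint u) intervalIntegrable_const]
    simp
  have hlow : ∀ u, τ * r u ≤ ∫ s in (0 : ℝ)..τ, x s u := fun u => by
    simpa using intervalIntegral.integral_mono_on_of_le_Ioo hτ.1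
      (f := fun _ => r u) intervalIntegrable_const (hint u) fun s hs => (hx s hs).1.2.1 u
  have hup : ∀ u, ∫ s in (0 : ℝ)..τ, x s u ≤ τ := fun u => by
    simpa using intervalIntegral.integral_mono_on_of_le_Ioo hτ.1 (hint u)
      (g := fun _ => (1 : ℝ)) intervalIntegrable_const fun s hs => (hx s hs).1.2.2.1 u
  have hry : ∀ u, r u ≤ y τ u := fun u => by linarith [hmotion u, hlow u]
  refine ⟨fun u => (hr0 u).trans (hry u), hry, fun u => ?_, ?_⟩
  · have := mul_le_mul_of_nonneg_left (hr1 u) (sub_nonneg.mpr hτ.2)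
    linarith [hmotion u, hup u]
  · have hsum : IntervalIntegrable (fun s => ∑ u, x s u) volume 0 τ := by
      simpa only [Finset.sum_fn] using IntervalIntegrable.sum Finset.univ fun u _ => hint u
    have hs : ∑ u, ∫ s in (0 : ℝ)..τ, x s u ≤ τ * k := by
      rw [← intervalIntegral.integral_finsetSum fun u _ => hint u]
      have := intervalIntegral.integral_mono_on_of_le_Ioo hτ.1
        (f := fun s => ∑ u, x s u) (g := fun _ => (k : ℝ))
        hsum intervalIntegrable_const
        fun s hs => (hx s hs).2.2.le
      simpa using this
    have := mul_le_mul_of_nonneg_left h.sum_le (sub_nonneg.mpr hτ.2)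
    simp only [hmotion, Finset.sum_add_distrib, Finset.sum_sub_distrib, ← Finset.mul_sum]
    linarith

/-- Lebesgue differentiation: `x` is only integrable, so the derivative exists almost everywhere.
Absolute continuity is then what lets it control increments. -/
theorem IsGreedyPath.ae_hasDerivAt (h : IsGreedyPath f k r x y) (u : N) :
    ∀ᵐ τ, τ ∈ Set.Ioo (0 : ℝ) 1 → HasDerivAt (fun s => y s u) (x τ u - r u) τ := by
  have hint : IntervalIntegrable (fun s => x s u - r u) volume 0 1 :=
    (h.integrable u).sub intervalIntegrable_const
  filter_upwards [hint.ae_hasDerivAt_integral] with τ hd hτ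
  rw [Set.uIcc_of_le zero_le_one] at hd
  have hd' := (hd (Set.Ioo_subset_Icc_self hτ) 0 (by simp)).const_add (r u)
  refine hd'.congr_of_eventuallyEq ?_
  filter_upwards [Ioo_mem_nhds hτ.1 hτ.2] with s hs
  exact h.motion s (Set.Ioo_subset_Icc_self hs) u

theorem _root_.AbsolutelyContinuousOnInterval.congr {X : Type*} [PseudoMetricSpace X]
    {g h : ℝ → X} {a b : ℝ} (hg : AbsolutelyContinuousOnInterval g a b)
    (hgh : Set.EqOn g h (Set.uIcc a b)) : AbsolutelyContinuousOnInterval h a b := by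
  rw [absolutelyContinuousOnInterval_iff] at hg ⊢
  intro ε hε
  obtain ⟨δ, hδ, H⟩ := hg ε hε
  refine ⟨δ, hδ, fun E hE hlen => (H E hE hlen).trans_eq' ?_⟩
  refine Finset.sum_congr rfl fun i hi => ?_
  rw [hgh (hE.1 i hi).1, hgh (hE.1 i hi).2]

theorem absolutelyContinuousOnInterval_finsetSum {ι : Type*} (s : Finset ι) {g : ι → ℝ → ℝ}
    {a b : ℝ} (hg : ∀ i ∈ s, AbsolutelyContinuousOnInterval (g i) a b) :
    AbsolutelyContinuousOnInterval (fun t => ∑ i ∈ s, g i t) a b := by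
  classical
  induction s using Finset.induction_on with
  | empty => simpa using (LipschitzWith.const (0 : ℝ)).lipschitzOnWith.absolutelyContinuousOnInterval
  | insert i s hi ih =>
    simp only [Finset.sum_insert hi]
    exact (hg i (Finset.mem_insert_self i s)).fun_add
      (ih fun j hj => hg j (Finset.mem_insert_of_mem hj))

theorem absolutelyContinuousOnInterval_finsetProd {ι : Type*} (s : Finset ι) {g : ι → ℝ → ℝ}
    {a b : ℝ} (hg : ∀ i ∈ s, AbsolutelyContinuousOnInterval (g i) a b) :
    AbsolutelyContinuousOnInterval (fun t => ∏ i ∈ s, g i t) a b := by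
  classical
  induction s using Finset.induction_on with
  | empty => simpa using (LipschitzWith.const (1 : ℝ)).lipschitzOnWith.absolutelyContinuousOnInterval
  | insert i s hi ih =>
    simp only [Finset.prod_insert hi]
    exact (hg i (Finset.mem_insert_self i s)).fun_mul
      (ih fun j hj => hg j (Finset.mem_insert_of_mem hj))

theorem absolutelyContinuousOnInterval_multilinearExt (f : Finset N → ℝ) {a b : ℝ}
    (hy : ∀ u, AbsolutelyContinuousOnInterval (fun τ => y τ u) a b) :
    AbsolutelyContinuousOnInterval (fun τ => multilinearExt f (y τ)) a b := by
  have hone : AbsolutelyContinuousOnInterval (fun _ : ℝ => (1 : ℝ)) a b :=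
    (LipschitzWith.const (1 : ℝ)).lipschitzOnWith.absolutelyContinuousOnInterval
  exact absolutelyContinuousOnInterval_finsetSum _ fun S _ => .const_mul _ <|
    (absolutelyContinuousOnInterval_finsetProd _ fun u _ => hy u).fun_mul <|
      absolutelyContinuousOnInterval_finsetProd _ fun u _ => hone.fun_sub (hy u)

theorem IsGreedyPath.absolutelyContinuousOnInterval (h : IsGreedyPath f k r x y) (u : N) :
    AbsolutelyContinuousOnInterval (fun τ => y τ u) 0 1 := by
  have hint : IntervalIntegrable (fun s => x s u - r u) volume 0 1 :=
    (h.integrable u).sub intervalIntegrable_const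
  have hconst : AbsolutelyContinuousOnInterval (fun _ : ℝ => r u) 0 1 :=
    (LipschitzWith.const (r u)).lipschitzOnWith.absolutelyContinuousOnInterval
  refine (hconst.fun_add (hint.absolutelyContinuousOnInterval_intervalIntegral
    (c := 0) (by simp))).congr fun τ hτ => ?_
  rw [Set.uIcc_of_le zero_le_one] at hτ
  exact (h.motion τ hτ u).symm

/-- Grönwall's inequality for an absolutely continuous function whose derivative is almost
everywhere at least `c * (U - g)`. -/
theorem le_of_ae_hasDerivAt_ge {g g' : ℝ → ℝ} {c U : ℝ}
    (hg : AbsolutelyContinuousOnInterval g 0 1)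
    (hd : ∀ᵐ τ, τ ∈ Set.Ioo (0 : ℝ) 1 → HasDerivAt g (g' τ) τ ∧ c * (U - g τ) ≤ g' τ) :
    (1 - 1 / Real.exp c) * U + g 0 / Real.exp c ≤ g 1 := by
  -- Integrating factor: the hypothesis makes the derivative of `G` nonnegative almost everywhere,
  -- so `G 0 ≤ G 1`.
  let G : ℝ → ℝ := fun τ => Real.exp (c * τ) * (g τ - U)
  have hexp : AbsolutelyContinuousOnInterval (fun τ => Real.exp (c * τ)) 0 1 :=
    ContDiffOn.absolutelyContinuousOnInterval (by fun_prop)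
  have hconst : AbsolutelyContinuousOnInterval (fun _ : ℝ => U) 0 1 :=
    (LipschitzWith.const U).lipschitzOnWith.absolutelyContinuousOnInterval
  have hG : AbsolutelyContinuousOnInterval G 0 1 := hexp.fun_mul (hg.fun_sub hconst)
  have hnonneg : 0 ≤ ∫ τ in (0 : ℝ)..1, deriv G τ := by
    rw [intervalIntegral.integral_of_le zero_le_one, integral_Ioc_eq_integral_Ioo]
    refine setIntegral_nonneg_ae measurableSet_Ioo ?_
    filter_upwards [hd] with τ hτ hmem
    obtain ⟨hderiv, hle⟩ := hτ hmem
    have h1 : HasDerivAt (fun τ => Real.exp (c * τ)) (Real.exp (c * τ) * c) τ := by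
      simpa using ((hasDerivAt_id τ).const_mul c).exp
    have h2 : HasDerivAt G _ τ := h1.mul (hderiv.sub_const U)
    rw [h2.deriv]
    have := mul_nonneg (Real.exp_pos (c * τ)).le (sub_nonneg.mpr hle)
    linarith
  rw [hG.integral_deriv_eq_sub] at hnonneg
  simp only [G, mul_one, mul_zero, Real.exp_zero, one_mul, sub_nonneg] at hnonneg
  have hc := Real.exp_pos c
  have heq : (1 - 1 / Real.exp c) * U + g 0 / Real.exp c = U + (g 0 - U) / Real.exp c := by
    field_simp
    ring
  rw [heq, ← le_sub_iff_add_le', div_le_iff₀' hc]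
  exact hnonneg

/-- The right-hand side is the derivative of the extension along the path wherever the path is
differentiable with velocity `x τ - r`. -/
theorem IsGreedyPath.rate_mul_le (h : IsGreedyPath f k r x y) (hf : Monotone f)
    (hs : IsSubmodular f) (hk : 1 ≤ k) (hr0 : ∀ u, 0 ≤ r u) (hr1 : ∀ u, r u ≤ 1)
    (hfeas : IsFeasible k r) {τ : ℝ} (hτ : τ ∈ Set.Ico (0 : ℝ) 1) :
    rate k r * (optUtility f k r - multilinearExt f (y τ)) ≤
      ∑ u, (x τ u - r u) * partialExt f (y τ) u := by
  have hy := h.mem_polytope hr0 hr1 (Set.Ico_subset_Icc_self hτ)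
  have hx := h.greedy τ hτ
  have hU : optUtility f k r ≤ multilinearExt f (y τ) + ∑ u, x τ u * weight f (y τ) u :=
    optUtility_le hfeas (hs.le_multilinearExt_add_sum hf hy.1 hy.2.2.1) hx.2.1
  have hrate : 0 ≤ rate k r := by linarith [one_sub_rate_le_one hk hr1 h.sum_le]
  calc rate k r * (optUtility f k r - multilinearExt f (y τ))
      ≤ rate k r * ∑ u, x τ u * weight f (y τ) u :=
        mul_le_mul_of_nonneg_left (by linarith) hrate
    _ ≤ ∑ u, (x τ u - r u) * weight f (y τ) u :=
        rate_mul_le_sum_sub_mul hk hr0 hr1 h.sum_le hx.2.1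
    _ ≤ _ := Finset.sum_le_sum fun u _ => mul_le_mul_of_nonneg_left
        (weight_le_partialExt hf hy.1 hy.2.2.1 u) (sub_nonneg.mpr (hx.1.2.1 u))

theorem IsGreedyPath.le_multilinearExt_one (h : IsGreedyPath f k r x y) (hf : Monotone f)
    (hs : IsSubmodular f) (hk : 1 ≤ k) (hr0 : ∀ u, 0 ≤ r u) (hr1 : ∀ u, r u ≤ 1)
    (hfeas : IsFeasible k r) :
    (1 - 1 / Real.exp (rate k r)) * optUtility f k r +
      multilinearExt f r / Real.exp (rate k r) ≤ multilinearExt f (y 1) := by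
  have h0 : y 0 = r := by
    ext u
    simp [h.motion 0 (by simp) u]
  have := le_of_ae_hasDerivAt_ge (c := rate k r) (U := optUtility f k r)
    (g' := fun τ => ∑ u, (x τ u - r u) * partialExt f (y τ) u)
    (absolutelyContinuousOnInterval_multilinearExt f h.absolutelyContinuousOnInterval) (by
      filter_upwards [ae_all_iff.mpr h.ae_hasDerivAt] with τ hd hτ
      exact ⟨hasDerivAt_multilinearExt_comp f fun u => hd u hτ,
        h.rate_mul_le hf hs hk hr0 hr1 hfeas (Set.Ioo_subset_Ico_self hτ)⟩)
  rwa [h0] at this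

end Path

end FairCG

theorem theorem4 {N : Type*} [Fintype N] [DecidableEq N]
    (f : Finset N → ℝ) (hf_mono : Monotone f) (hf_sub : FairCG.IsSubmodular f) (hf_empty : f ∅ = 0)
    (k : ℕ) (hk_pos : 1 ≤ k) (hk_le : k ≤ Fintype.card N)
    (r : N → ℝ) (hr : ∀ u, r u ∈ Set.Icc (0 : ℝ) 1) (hr_feas : FairCG.IsFeasible k r)
    (x y : ℝ → N → ℝ)
    {Ω : Type*} [MeasurableSpace Ω] (P : MeasureTheory.Measure Ω)
    [MeasureTheory.IsProbabilityMeasure P] (S : ℕ → Ω → Finset N)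
    (hrun : FairCG.IsFairCG2Run f k r x y P S) :
    (∀ τ ∈ Set.Icc (0 : ℝ) 1, y τ ∈ FairCG.polytope k r) ∧
      (1 - 1 / Real.exp (FairCG.rate k r)) * FairCG.optUtility f k r +
          FairCG.multilinearExt f r / Real.exp (FairCG.rate k r) ≤
        FairCG.avgUtility f P S := by
  have hr0 := fun u => (hr u).1
  have hr1 := fun u => (hr u).2
  refine ⟨fun τ hτ => hrun.path.mem_polytope hr0 hr1 hτ, ?_⟩
  refine (hrun.path.le_multilinearExt_one hf_mono hf_sub hk_pos hr0 hr1 hr_feas).trans ?_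
  refine FairCG.le_avgUtility hrun.randomSeq fun t => ?_
  have hy := hrun.path.mem_polytope hr0 hr1 (τ := 1) (by simp)
  rw [hrun.randomSeq.integral_eq_sum]
  exact (hrun.rounding t).multilinearExt_le hf_sub fun u => ⟨hy.1 u, hy.2.2.1 u⟩
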